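/- Let $K$ be a field and let $s,t,m\ge 0$ be integers such that $2$, $m!$, $s!$ and $t!$ are nonzero in $K$ (for instance $K=\mathbb R$ or any field of characteristic $0$). For a matrix $A=\begin{bmatrix}A_1\\A_2\end{bmatrix}\in K^{(s+t)\times m}$ with $A_1\in K^{s\times m}$ and $A_2\in K^{t\times m}$, define its generalized singular value characteristic polynomial (GSVCP) $$p_A(x,y,z)=\det\left(xI+yA_1^TA_1+zA_2^TA_2\right)\in K[x,y,z].$$ Let $M,N\in K^{(s+t)\times m}$ have blocks $M_1,M_2$ and $N_1,N_2$, and let $W$ be the random matrix with blocks $$W_1=M_1+R_1N_1U,\qquad W_2=M_2+R_2N_2U,$$ where $R_1,R_2,U$ are independent and uniformly distributed on the signed permutation matrices of sizes $s\times s$, $t\times t$ and $m\times m$ respectively, and the expectation $\mathbb E$ is the uniform average over all triples $(R_1,R_2,U)$, which makes sense in $K$. Then there are bivariate polynomials $P$ and $Q$ over $K$ with $$y^sz^t\,p_M(x,1/y,1/z)=P(\partial_x\partial_y,\partial_x\partial_z)\{x^my^sz^t\},\qquad y^sz^t\,p_N(x,1/y,1/z)=Q(\partial_x\partial_y,\partial_x\partial_z)\{x^my^sz^t\},$$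 and for all bivariate polynomials $P$ and $Q$ over $K$ that satisfy these two identities, $$\mathbb E_{R_1,R_2,U}\left[y^sz^t\,p_W(x,1/y,1/z)\right]=P(\partial_x\partial_y,\partial_x\partial_z)\,Q(\partial_x\partial_y,\partial_x\partial_z)\{x^my^sz^t\},$$ where the product of the two differential operators is their composition. All identities are identities in the field of rational functions $K(x,y,z)$. -/

import Mathlib

open MvPolynomial BigOperators

noncomputable section

namespace GSVD

/-- The finite set of `n × n` signed permutation matrices over `K`: the products of a diagonal
matrix with diagonal entries `±1` and a permutation matrix. -/
def signedPermMatrices (K : Type*) [Field K] (n : ℕ) : Finset (Matrix (Fin n) (Fin n) K) := by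
  classical exact
  Finset.univ.image fun p : (Fin n → ℤˣ) × Equiv.Perm (Fin n) =>
    Matrix.diagonal (fun i => (((p.1 i : ℤˣ) : ℤ) : K)) * p.2.permMatrix K

/-- The expectation `|S|⁻¹ ∑_{a ∈ S} f a` of `f a` for `a` uniformly distributed on the finite
set `S`. -/
def uniformExpect {ι L : Type*} [Field L] (S : Finset ι) (f : ι → L) : L :=
  (S.card : L)⁻¹ * ∑ a ∈ S, f a

variable {K : Type*} [Field K] {s t m : ℕ}

/-- The generalized singular value characteristic polynomial
`p_A(x, y, z) = det (x I + y A₁ᵀ A₁ + z A₂ᵀ A₂)` of a matrix `A` with an upper block `A₁` of `s`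
rows and a lower block `A₂` of `t` rows; `x = X 0`, `y = X 1`, `z = X 2`. -/
def gsvcp (A : Matrix (Fin s ⊕ Fin t) (Fin m) K) : MvPolynomial (Fin 3) K :=
  Matrix.det
    ((X 0 : MvPolynomial (Fin 3) K) • (1 : Matrix (Fin m) (Fin m) (MvPolynomial (Fin 3) K))
      + (X 1 : MvPolynomial (Fin 3) K) • (A.toRows₁.transpose * A.toRows₁).map C
      + (X 2 : MvPolynomial (Fin 3) K) • (A.toRows₂.transpose * A.toRows₂).map C)

/-- The variables `x, y, z` as elements of the field of rational functions `K(x, y, z)`. -/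
def ratVar (K : Type*) [Field K] (i : Fin 3) : FractionRing (MvPolynomial (Fin 3) K) :=
  algebraMap (MvPolynomial (Fin 3) K) (FractionRing (MvPolynomial (Fin 3) K)) (X i)

/-- The transformed polynomial `y^s z^t p_A(x, 1/y, 1/z)`, as an element of `K(x, y, z)`. -/
def transformedGsvcp (A : Matrix (Fin s ⊕ Fin t) (Fin m) K) :
    FractionRing (MvPolynomial (Fin 3) K) :=
  ratVar K 1 ^ s * ratVar K 2 ^ t *
    aeval ![ratVar K 0, (ratVar K 1)⁻¹, (ratVar K 2)⁻¹] (gsvcp A)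

/-- The partial derivative `∂ᵢ` as a linear operator on `K[x, y, z]`. -/
def partialOp (K : Type*) [Field K] (i : Fin 3) : Module.End K (MvPolynomial (Fin 3) K) :=
  (pderiv i : Derivation K (MvPolynomial (Fin 3) K) (MvPolynomial (Fin 3) K)).toLinearMap

/-- The operator `P(∂x ∂y, ∂x ∂z)` on `K[x, y, z]`, for a bivariate polynomial `P`.
Multiplication in `Module.End` is composition of operators. -/
def diffOp (P : MvPolynomial (Fin 2) K) : Module.End K (MvPolynomial (Fin 3) K) :=
  ∑ α ∈ P.support, P.coeff α •
    ((partialOp K 0 * partialOp K 1) ^ α 0 * (partialOp K 0 * partialOp K 2) ^ α 1)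

/-- The monomial `x^m y^s z^t`. -/
def baseMonomial (K : Type*) [Field K] (m s t : ℕ) : MvPolynomial (Fin 3) K :=
  X 0 ^ m * X 1 ^ s * X 2 ^ t

/-- The identity `y^s z^t p_A(x, 1/y, 1/z) = P(∂x ∂y, ∂x ∂z){x^m y^s z^t}`. -/
def IsSymbol (A : Matrix (Fin s ⊕ Fin t) (Fin m) K) (P : MvPolynomial (Fin 2) K) : Prop :=
  transformedGsvcp A =
    algebraMap (MvPolynomial (Fin 3) K) (FractionRing (MvPolynomial (Fin 3) K))
      (diffOp P (baseMonomial K m s t))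

/-- The matrix with blocks `W₁ = M₁ + R₁ N₁ Q` and `W₂ = M₂ + R₂ N₂ Q`. -/
def blockSum (M N : Matrix (Fin s ⊕ Fin t) (Fin m) K) (R₁ : Matrix (Fin s) (Fin s) K)
    (R₂ : Matrix (Fin t) (Fin t) K) (Q : Matrix (Fin m) (Fin m) K) :
    Matrix (Fin s ⊕ Fin t) (Fin m) K :=
  Matrix.fromRows (M.toRows₁ + R₁ * N.toRows₁ * Q) (M.toRows₂ + R₂ * N.toRows₂ * Q)

end GSVD

end

/-! Let D be the diagonal matrix carrying x on columns, y on upper rows and z on lower rows, and let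
B_A be the skew matrix with off-diagonal blocks Aᵀ and -A. A Schur complement gives y^s z^t
p_A(x,1/y,1/z) = det(D + B_A) (`transformedGsvcp_eq_det`). The randomness becomes B_W = B_M + (B_N
conjugated by a signed permutation preserving the three index classes, called colours).

Averaging over the signs leaves only products of complementary principal minors, of D + B_M on S and
of the permuted B_N on Sᶜ (`sum_det_add_signConj`). Differentiating a principal minor of D + B_M in
one variable sums the minors with one index of that colour deleted. Hence averaging over
permutations within colours turns each minor on the complement of V into an iterated derivative of
det(D + B_M), divided by falling factorials (`descFactorial_smul_orbitSum`). Since B_N is bipartite,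
its nonzero minors use as many columns as rows, so these derivatives are products of ∂x∂y and ∂x∂z.
The average is therefore an explicit operator, determined by N, applied to det(D + B_M)
(`sum_sum_det_eq_diffOp`).

Taking M = 0 shows that this operator is a symbol of N, since D is invariant under the averaging.
For arbitrary symbols P and Q only their values on x^m y^s z^t matter, because the operators
commute. -/

noncomputable section

namespace GSVD

/-! ### Principal minors and averages over sign conjugations -/

section SignAverage

variable {ι R : Type*} [Fintype ι] [DecidableEq ι] [CommRing R]

/-- The matrix that agrees with `B` on `S × S` and with the identity matrix elsewhere. -/
def blockExtend (B : Matrix ι ι R) (S : Finset ι) : Matrix ι ι R :=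
  Matrix.of fun i j => if i ∈ S ∧ j ∈ S then B i j else if i = j then 1 else 0

/-- The principal minor of `B` with index set `S`. -/
def principalMinor (B : Matrix ι ι R) (S : Finset ι) : R := (blockExtend B S).det

/-- Conjugation of `B` by the diagonal matrix with diagonal entries `δ i`. -/
def signConj (δ : ι → ℤˣ) (B : Matrix ι ι R) : Matrix ι ι R :=
  Matrix.of fun i j => ((δ i : ℤ) : R) * ((δ j : ℤ) : R) * B i j

lemma principalMinor_univ (B : Matrix ι ι R) : principalMinor B Finset.univ = B.det := by
  unfold principalMinor
  congr 1
  ext i j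
  simp [blockExtend]

/-- Makes a product of complementary principal minors a single determinant, that of a block diagonal
matrix. -/
lemma blockExtend_mul_compl (B C : Matrix ι ι R) (S : Finset ι) :
    blockExtend B S * blockExtend C Sᶜ = Matrix.of fun i j =>
      if i ∈ S then (if j ∈ S then B i j else 0) else if j ∈ S then 0 else C i j := by
  ext i j
  rw [Matrix.mul_apply]
  simp only [blockExtend, Matrix.of_apply, Finset.mem_compl]
  by_cases hi : i ∈ S
  · by_cases hj : j ∈ S
    · rw [Finset.sum_eq_single j]
      · simp [hi, hj]
      · intro b _ hb
        simp [hj, hb]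
      · simp
    · simp only [hi, hj, if_true, if_false]
      apply Finset.sum_eq_zero
      intro l _
      by_cases hl : l ∈ S
      · have : l ≠ j := fun h => hj (h ▸ hl)
        simp [hl, this]
      · have : i ≠ l := fun h => hl (h ▸ hi)
        simp [hl, this]
  · rw [Finset.sum_eq_single i]
    · by_cases hj : j ∈ S
      · have : i ≠ j := fun h => hi (h ▸ hj)
        simp [hi, hj, this]
      · simp [hi, hj]
    · intro b _ hb
      simp [hi, hb.symm]
    · simp

/-- If `σ` preserves `U`, every sign occurs squared. Otherwise some `j ∈ U` lies outside `σ(U)`, its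
sign occurs exactly once, and flipping it cancels the terms in pairs. -/
lemma sum_sign_prod (σ : Equiv.Perm ι) (U : Finset ι) :
    ∑ δ : ι → ℤˣ, ∏ i ∈ U, (((δ (σ i) : ℤ) : R) * ((δ i : ℤ) : R)) =
      if ∀ i ∈ U, σ i ∈ U then (2 : R) ^ Fintype.card ι else 0 := by
  split_ifs with h
  · have hU : U.map σ.toEmbedding = U := by
      apply Finset.eq_of_subset_of_card_le
      · intro x hx
        obtain ⟨i, hi, rfl⟩ := Finset.mem_map.1 hx
        exact h i hi
      · simp
    have key : ∀ δ : ι → ℤˣ, ∏ i ∈ U, (((δ (σ i) : ℤ) : R) * ((δ i : ℤ) : R)) = 1 := by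
      intro δ
      have h1 : ∏ i ∈ U, ((δ (σ i) : ℤ) : R) = ∏ i ∈ U, ((δ i : ℤ) : R) := by
        conv_rhs => rw [← hU, Finset.prod_map]
        rfl
      rw [Finset.prod_mul_distrib, h1, ← Finset.prod_mul_distrib]
      apply Finset.prod_eq_one
      intro i _
      rcases Int.units_eq_one_or (δ i) with h | h <;> simp [h]
    simp [key]
  · push Not at h
    obtain ⟨k, hk, hσk⟩ := h
    obtain ⟨j, hj, hjn⟩ : ∃ j ∈ U, j ∉ U.map σ.toEmbedding := by
      by_contra! hc
      have : U = U.map σ.toEmbedding := by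
        apply Finset.eq_of_subset_of_card_le hc
        simp
      exact hσk (this ▸ Finset.mem_map_of_mem _ hk)
    have hne : ∀ i ∈ U, σ i ≠ j := fun i hi h =>
      hjn (h ▸ Finset.mem_map_of_mem σ.toEmbedding hi)
    apply Finset.sum_involution (fun δ _ => Function.update δ j (-δ j))
    · intro δ _
      rw [← Finset.mul_prod_erase U _ hj, ← Finset.mul_prod_erase U _ hj]
      have : ∏ x ∈ U.erase j, (((Function.update δ j (-δ j) (σ x) : ℤˣ) : ℤ) : R) *
          (((Function.update δ j (-δ j) x : ℤˣ) : ℤ) : R) =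
          ∏ x ∈ U.erase j, ((δ (σ x) : ℤ) : R) * ((δ x : ℤ) : R) := by
        apply Finset.prod_congr rfl
        intro x hx
        rw [Function.update_of_ne (hne x (Finset.mem_of_mem_erase hx)),
          Function.update_of_ne (Finset.ne_of_mem_erase hx)]
      rw [this, Function.update_of_ne (hne j hj), Function.update_self]
      push_cast
      ring
    · intro δ _ _ h
      have := congrFun h j
      rw [Function.update_self] at this
      rcases Int.units_eq_one_or (δ j) with h | h <;> rw [h] at this <;> exact absurd this (by decide)
    · intro δ _
      simp
    · intro δ _
      simp

/-- Averaging over the conjugations of `C` by sign matrices splits the determinant of a sum into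
products of complementary principal minors. -/
theorem sum_det_add_signConj (B C : Matrix ι ι R) :
    ∑ δ : ι → ℤˣ, (B + signConj δ C).det =
      2 ^ Fintype.card ι * ∑ S : Finset ι, principalMinor B S * principalMinor C Sᶜ := by
  have h1 : ∀ δ : ι → ℤˣ, (B + signConj δ C).det = ∑ S : Finset ι, ∑ σ : Equiv.Perm ι,
      ((Equiv.Perm.sign σ : ℤ) : R) * ((∏ i ∈ S, B (σ i) i) * ∏ i ∈ Sᶜ, C (σ i) i) *
        ∏ i ∈ Sᶜ, (((δ (σ i) : ℤ) : R) * ((δ i : ℤ) : R)) := by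
    intro δ
    rw [Matrix.det_apply', Finset.sum_comm]
    apply Finset.sum_congr rfl
    intro σ _
    simp only [Matrix.add_apply, signConj, Matrix.of_apply]
    rw [Finset.prod_add, Finset.mul_sum, Finset.powerset_univ]
    apply Finset.sum_congr rfl
    intro S _
    rw [← Finset.compl_eq_univ_sdiff, Finset.prod_mul_distrib]
    ring
  simp_rw [h1]
  rw [Finset.sum_comm, Finset.mul_sum]
  apply Finset.sum_congr rfl
  intro S _
  rw [Finset.sum_comm]
  simp_rw [← Finset.mul_sum, sum_sign_prod]
  rw [principalMinor, principalMinor, ← Matrix.det_mul, blockExtend_mul_compl, Matrix.det_apply',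
    Finset.mul_sum]
  apply Finset.sum_congr rfl
  intro σ _
  split_ifs with h
  · have hS : ∀ i, σ i ∈ S ↔ i ∈ S := by
      have hU : Sᶜ.map σ.toEmbedding = Sᶜ := by
        apply Finset.eq_of_subset_of_card_le
        · intro x hx
          obtain ⟨i, hi, rfl⟩ := Finset.mem_map.1 hx
          exact h i hi
        · simp
      intro i
      rw [← not_iff_not, ← Finset.mem_compl, ← Finset.mem_compl]
      nth_rewrite 1 [← hU]
      simp
    rw [← Finset.prod_mul_prod_compl S, mul_comm]
    congr 2
    congr 1 <;> apply Finset.prod_congr rfl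
    · intro i hi
      simp [hS, hi]
    · intro i hi
      have := Finset.mem_compl.1 hi
      simp [hS, this]
  -- Here `σ` sends some index of `Sᶜ` into `S`, where the block diagonal matrix has a zero entry.
  · push Not at h
    obtain ⟨k, hk, hσk⟩ := h
    rw [Finset.mem_compl, not_not] at hσk
    rw [Finset.mem_compl] at hk
    rw [Finset.prod_eq_zero (Finset.mem_univ k) (by simp [hk, hσk])]
    simp

lemma signConj_diagonal {ι R : Type*} [DecidableEq ι] [CommRing R] (δ : ι → ℤˣ) (d : ι → R) :
    signConj δ (Matrix.diagonal d) = Matrix.diagonal d := by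
  ext i j
  by_cases h : i = j
  · subst h
    rcases Int.units_eq_one_or (δ i) with h | h <;> simp [signConj, h]
  · simp [signConj, h]

lemma det_signConj (δ : ι → ℤˣ) (B : Matrix ι ι R) : (signConj δ B).det = B.det := by
  have h : signConj δ B = Matrix.diagonal (fun i => ((δ i : ℤ) : R)) * B *
      Matrix.diagonal (fun i => ((δ i : ℤ) : R)) := by
    ext i j
    simp only [signConj, Matrix.of_apply, Matrix.mul_diagonal, Matrix.diagonal_mul]
    ring
  rw [h, Matrix.det_mul, Matrix.det_mul, mul_right_comm, ← Matrix.det_mul,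
    Matrix.diagonal_mul_diagonal]
  have h1 : ∀ i, ((δ i : ℤ) : R) * ((δ i : ℤ) : R) = 1 := by
    intro i
    rcases Int.units_eq_one_or (δ i) with h | h <;> simp [h]
  simp [h1]

lemma principalMinor_diagonal (d : ι → R) (S : Finset ι) :
    principalMinor (Matrix.diagonal d) S = ∏ i ∈ S, d i := by
  have : blockExtend (Matrix.diagonal d) S =
      Matrix.diagonal (fun i => if i ∈ S then d i else 1) := by
    ext i j
    by_cases h : i = j
    · subst h
      simp [blockExtend]
    · simp [blockExtend, h]
  rw [principalMinor, this, Matrix.det_diagonal, Finset.prod_ite_mem]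
  simp

/-- The expansion of `det (B + diag d)` into principal minors of `B`. -/
theorem det_add_diagonal (h2 : IsUnit (2 : R)) (B : Matrix ι ι R) (d : ι → R) :
    (B + Matrix.diagonal d).det = ∑ S : Finset ι, principalMinor B S * ∏ i ∈ Sᶜ, d i := by
  -- Sign conjugation fixes diagonal matrices, so all summands on the left are equal and the factor
  -- `2 ^ card ι` cancels.
  have h := sum_det_add_signConj B (Matrix.diagonal d)
  have hc : Fintype.card (ι → ℤˣ) = 2 ^ Fintype.card ι := by simp
  simp only [signConj_diagonal, principalMinor_diagonal, Finset.sum_const, Finset.card_univ,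
    nsmul_eq_mul, hc] at h
  push_cast at h
  exact (h2.pow _).mul_left_cancel h

/-- The expansion of the principal minors of `B + diag d`. -/
theorem principalMinor_add_diagonal (h2 : IsUnit (2 : R)) (B : Matrix ι ι R) (d : ι → R)
    (S : Finset ι) :
    principalMinor (B + Matrix.diagonal d) S =
      ∑ V ∈ S.powerset, principalMinor B V * ∏ i ∈ S \ V, d i := by
  have h1 : blockExtend (B + Matrix.diagonal d) S =
      Matrix.of (fun i j => if i ∈ S ∧ j ∈ S then B i j else 0) +
        Matrix.diagonal (fun i => if i ∈ S then d i else 1) := by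
    ext i j
    by_cases h : i = j
    · subst h
      by_cases hi : i ∈ S <;> simp [blockExtend, hi]
    · by_cases hi : i ∈ S <;> by_cases hj : j ∈ S <;> simp [blockExtend, hi, hj, h]
  -- The matrix truncated to `S × S` has zero rows outside `S`, so only subsets of `S` contribute.
  rw [principalMinor, h1, det_add_diagonal h2]
  symm
  apply Finset.sum_subset_zero_on_sdiff (Finset.subset_univ _)
  · intro V hV
    rw [Finset.mem_sdiff, Finset.mem_powerset, Finset.not_subset] at hV
    obtain ⟨k, hk, hkS⟩ := hV.2
    rw [principalMinor, Matrix.det_eq_zero_of_row_eq_zero k, zero_mul]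
    intro j
    by_cases hj : j ∈ V
    · simp [blockExtend, hk, hkS, hj]
    · have : k ≠ j := fun h => hj (h ▸ hk)
      simp [blockExtend, hj, this]
  · intro V hV
    rw [Finset.mem_powerset] at hV
    congr 1
    · unfold principalMinor
      congr 1
      ext i j
      simp only [blockExtend, Matrix.of_apply]
      by_cases h : i ∈ V ∧ j ∈ V
      · simp [h, hV h.1, hV h.2]
      · simp [h]
    · rw [Finset.prod_ite, Finset.prod_const_one, mul_one]
      apply Finset.prod_congr _ fun _ _ => rfl
      ext i
      simp [and_comm]

lemma principalMinor_submatrix (B : Matrix ι ι R) (π : Equiv.Perm ι) (S : Finset ι) :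
    principalMinor (B.submatrix π π) S = principalMinor B (S.map π.toEmbedding) := by
  unfold principalMinor
  rw [← Matrix.det_submatrix_equiv_self π (blockExtend B _)]
  congr 1
  ext i j
  simp [blockExtend]

lemma principalMinor_map {R' : Type*} [CommRing R'] (f : R →+* R') (B : Matrix ι ι R)
    (S : Finset ι) : principalMinor (B.map f) S = f (principalMinor B S) := by
  unfold principalMinor
  rw [RingHom.map_det]
  congr 1
  ext i j
  simp only [blockExtend, Matrix.of_apply, RingHom.mapMatrix_apply, Matrix.map_apply]
  split_ifs <;> simp

/-- A principal minor of a bipartite matrix vanishes unless it uses equally many indices of the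
two parts. -/
lemma principalMinor_eq_zero_of_bipartite (B : Matrix ι ι R) (p : ι → Prop) [DecidablePred p]
    (hB : ∀ i j, (p i ↔ p j) → B i j = 0) (S : Finset ι)
    (hS : (S.filter p).card ≠ (S.filter fun i => ¬ p i).card) : principalMinor B S = 0 := by
  rw [principalMinor, Matrix.det_apply']
  apply Finset.sum_eq_zero
  intro σ _
  by_contra hne
  have hprod := right_ne_zero_of_mul hne
  have hent : ∀ i, blockExtend B S (σ i) i ≠ 0 := fun i h =>
    hprod (Finset.prod_eq_zero (Finset.mem_univ i) h)
  -- A permutation with a nonzero term preserves `S` and exchanges its two parts, which forces them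
  -- to have equal size.
  have key : ∀ i ∈ S, σ i ∈ S ∧ ¬ (p (σ i) ↔ p i) := by
    intro i hi
    have h := hent i
    by_cases hs : σ i ∈ S
    · refine ⟨hs, fun hp => h ?_⟩
      simp [blockExtend, hs, hi, hB _ _ hp]
    · have : σ i ≠ i := fun h => hs (h.symm ▸ hi)
      simp [blockExtend, hs, this] at h
  apply hS
  apply le_antisymm <;> apply Finset.card_le_card_of_injOn σ _ σ.injective.injOn <;> intro i hi <;>
    have hi := Finset.mem_filter.1 (Finset.mem_coe.1 hi) <;>
    have := key i hi.1 <;> simp <;> tauto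

end SignAverage

/-! ### Derivatives as deletion of coloured indices -/

section ColoredSets

variable {ι : Type*} [Fintype ι] [DecidableEq ι] (col : ι → Fin 3)

/-- The number of elements of `V` of colour `c`. -/
def colorCount (V : Finset ι) (c : Fin 3) : ℕ := (V.filter fun i => col i = c).card

omit [Fintype ι] in
lemma colorCount_insert {V : Finset ι} {k : ι} (hk : k ∉ V) (c : Fin 3) :
    colorCount col (insert k V) c = colorCount col V c + if col k = c then 1 else 0 := by
  unfold colorCount
  rw [Finset.filter_insert]
  split_ifs with h
  · rw [Finset.card_insert_of_notMem (by simp [hk])]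
  · rfl

lemma colorCount_compl (V : Finset ι) (c : Fin 3) :
    colorCount col Vᶜ c = colorCount col Finset.univ c - colorCount col V c := by
  have h : colorCount col Finset.univ c = colorCount col V c + colorCount col Vᶜ c := by
    unfold colorCount
    rw [← Finset.card_union_of_disjoint, ← Finset.filter_union, Finset.union_compl]
    exact Finset.disjoint_filter_filter disjoint_compl_right
  omega

omit [DecidableEq ι] in
lemma colorCount_le (V : Finset ι) (c : Fin 3) :
    colorCount col V c ≤ colorCount col Finset.univ c :=
  Finset.card_le_card (Finset.filter_subset_filter _ (Finset.subset_univ V))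

variable {K : Type*} [Field K]

omit [Fintype ι] in
lemma pderiv_prod_X (c : Fin 3) (U : Finset ι) :
    pderiv c (∏ i ∈ U, (X (col i) : MvPolynomial (Fin 3) K)) =
      ∑ k ∈ U with col k = c, ∏ i ∈ U.erase k, X (col i) := by
  induction U using Finset.induction_on with
  | empty => simp
  | insert a U ha ih =>
    rw [Finset.prod_insert ha, pderiv_mul, ih, Finset.sum_filter, Finset.sum_filter,
      Finset.sum_insert ha, Finset.erase_insert ha, pderiv_X, Finset.mul_sum]
    congr 1
    · by_cases h : col a = c
      · simp [h]
      · rw [Pi.single_eq_of_ne h]; simp [h]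
    · apply Finset.sum_congr rfl
      intro k hk
      have hka : a ≠ k := fun h => ha (h ▸ hk)
      rw [Finset.erase_insert_of_ne hka, Finset.prod_insert (by simp [ha])]
      split_ifs <;> simp

/-- The determinant of the principal submatrix on `S` of the sum of `B` and the diagonal matrix of
variables prescribed by `col`, expanded in principal minors of `B`. -/
def minorPoly (B : Matrix ι ι K) (S : Finset ι) : MvPolynomial (Fin 3) K :=
  ∑ V ∈ S.powerset, C (principalMinor B V) * ∏ i ∈ S \ V, X (col i)

/-- Each variable sits on the diagonal, so differentiating deletes an index `k ∈ S \ V`; for fixed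
`k` the remaining `V` are the subsets of `S.erase k`. -/
lemma pderiv_minorPoly (B : Matrix ι ι K) (c : Fin 3) (S : Finset ι) :
    pderiv c (minorPoly col B S) = ∑ k ∈ S with col k = c, minorPoly col B (S.erase k) := by
  simp only [minorPoly, map_sum, pderiv_C_mul, pderiv_prod_X, Finset.mul_sum]
  rw [Finset.sum_comm' (t' := S.filter fun k => col k = c) (s' := fun k => (S.erase k).powerset)]
  · apply Finset.sum_congr rfl
    intro k _
    apply Finset.sum_congr rfl
    intro V _
    rw [Finset.erase_sdiff_comm]
  · intro V k
    simp only [Finset.mem_powerset, Finset.mem_filter, Finset.mem_sdiff, Finset.subset_erase]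
    tauto

/-- The commutator of two derivations is a derivation, and this one kills every variable. -/
lemma partialOp_commute (i j : Fin 3) : Commute (partialOp K i) (partialOp K j) := by
  have h : ⁅(pderiv i : Derivation K (MvPolynomial (Fin 3) K) (MvPolynomial (Fin 3) K)),
      (pderiv j : Derivation K (MvPolynomial (Fin 3) K) (MvPolynomial (Fin 3) K))⁆ = 0 := by
    apply MvPolynomial.derivation_ext
    intro k
    rw [Derivation.commutator_apply, pderiv_X, pderiv_X]
    rcases eq_or_ne k i with rfl | hi <;> rcases eq_or_ne k j with rfl | hj <;> simp [*]
  apply LinearMap.ext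
  intro f
  have h' := DFunLike.congr_fun h f
  rw [Derivation.commutator_apply] at h'
  exact sub_eq_zero.1 h'

/-- The operator `∂₀^{v₀} ∂₁^{v₁} ∂₂^{v₂}` with `v` the colour counts of `V`. -/
def colorDeriv (K : Type*) [Field K] (V : Finset ι) : Module.End K (MvPolynomial (Fin 3) K) :=
  partialOp K 0 ^ colorCount col V 0 * partialOp K 1 ^ colorCount col V 1 *
    partialOp K 2 ^ colorCount col V 2

omit [Fintype ι] in
lemma colorDeriv_insert {V : Finset ι} {k : ι} (hk : k ∉ V) :
    colorDeriv col K (insert k V) = partialOp K (col k) * colorDeriv col K V := by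
  unfold colorDeriv
  simp only [colorCount_insert col hk]
  have h10 : Commute (partialOp K 1) (partialOp K 0 ^ colorCount col V 0) :=
    (partialOp_commute 1 0).pow_right _
  have h20 : Commute (partialOp K 2) (partialOp K 0 ^ colorCount col V 0) :=
    (partialOp_commute 2 0).pow_right _
  have h21 : Commute (partialOp K 2) (partialOp K 1 ^ colorCount col V 1) :=
    (partialOp_commute 2 1).pow_right _
  obtain h | h | h : col k = 0 ∨ col k = 1 ∨ col k = 2 := by
    generalize col k = c
    fin_cases c <;> simp
  · simp [h, pow_succ', mul_assoc]
  · simp only [h, ← mul_assoc, h10.eq]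
    simp [pow_succ', ← mul_assoc]
  · simp [h, pow_succ', ← mul_assoc]
    rw [h20.eq, mul_assoc _ (partialOp K 2) (partialOp K 1 ^ _), h21.eq, ← mul_assoc]

/-! ### Averages over colour-preserving permutations -/

variable {H : Type*} [Group H] [Fintype H] (Φ : H →* Equiv.Perm ι)

/-- The sum of `F` over the complements of the translates of `V` under the group `H`. -/
def orbitSum (F : Finset ι → MvPolynomial (Fin 3) K) (V : Finset ι) : MvPolynomial (Fin 3) K :=
  ∑ h : H, F (V.map (Φ h).toEmbedding)ᶜ

lemma orbitSum_map (F : Finset ι → MvPolynomial (Fin 3) K) (V : Finset ι) (g : H) :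
    orbitSum Φ F (V.map (Φ g).toEmbedding) = orbitSum Φ F V := by
  unfold orbitSum
  rw [← Equiv.sum_comp (Equiv.mulRight g) fun h => F (V.map (Φ h).toEmbedding)ᶜ]
  apply Finset.sum_congr rfl
  intro h _
  rw [Finset.map_map]
  simp only [Equiv.coe_mulRight, map_mul]
  rfl

variable (hcol : ∀ h i, col (Φ h i) = col i)
  (hswap : ∀ i j, col i = col j → ∃ h, Φ h = Equiv.swap i j)

include hswap in
lemma orbitSum_insert_congr (F : Finset ι → MvPolynomial (Fin 3) K) {V : Finset ι} {k l : ι}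
    (hk : k ∉ V) (hl : l ∉ V) (h : col k = col l) :
    orbitSum Φ F (insert k V) = orbitSum Φ F (insert l V) := by
  obtain ⟨g, hg⟩ := hswap k l h
  rw [← orbitSum_map Φ F (insert k V) g, hg, Finset.map_insert]
  congr 2
  · simp
  · ext x
    simp only [Finset.mem_map_equiv, Equiv.symm_swap]
    by_cases hxk : x = k
    · subst hxk; simp [hk, hl]
    · by_cases hxl : x = l
      · subst hxl; simp [hk, hl]
      · rw [Equiv.swap_apply_of_ne_of_ne hxk hxl]

include hcol hswap in
-- Deleting an index from the complement of a translate enlarges `V` by one index of that colour.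
-- All choices give the same orbit sum, because a transposition in the group relates any two, so the
-- coefficient counts the choices.
lemma pderiv_orbitSum (F : Finset ι → MvPolynomial (Fin 3) K)
    (hF : ∀ c S, pderiv c (F S) = ∑ k ∈ S with col k = c, F (S.erase k))
    {V : Finset ι} {k : ι} (hk : k ∉ V) :
    pderiv (col k) (orbitSum Φ F V) =
      ((colorCount col Finset.univ (col k) - colorCount col V (col k) : ℕ) : K) •
        orbitSum Φ F (insert k V) := by
  have h1 : pderiv (col k) (orbitSum Φ F V) =
      ∑ l ∈ Vᶜ with col l = col k, orbitSum Φ F (insert l V) := by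
    unfold orbitSum
    rw [map_sum, Finset.sum_comm]
    apply Finset.sum_congr rfl
    intro h _
    rw [hF]
    symm
    apply Finset.sum_equiv (Φ h)
    · intro l
      simp [hcol]
    · intro l _
      congr 1
      ext x
      simp [Finset.map_insert]
  rw [h1, Finset.sum_congr rfl (g := fun _ => orbitSum Φ F (insert k V)), Finset.sum_const,
    ← colorCount_compl, Nat.cast_smul_eq_nsmul]
  · rfl
  · intro l hl
    rw [Finset.mem_filter, Finset.mem_compl] at hl
    exact orbitSum_insert_congr col Φ hswap F hl.1 hk hl.2

include hcol hswap in
/-- A function on sets whose derivatives remove one element averages, over a group that mixes the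
elements of each colour, to multiples of its derivatives. -/
theorem descFactorial_smul_orbitSum (F : Finset ι → MvPolynomial (Fin 3) K)
    (hF : ∀ c S, pderiv c (F S) = ∑ k ∈ S with col k = c, F (S.erase k)) (V : Finset ι) :
    (∏ c, ((colorCount col Finset.univ c).descFactorial (colorCount col V c) : K)) •
        orbitSum Φ F V = (Fintype.card H : K) • colorDeriv col K V (F Finset.univ) := by
  induction V using Finset.induction_on with
  | empty =>
    simp [colorCount, colorDeriv, orbitSum, Nat.cast_smul_eq_nsmul]
  | insert k V hk ih =>
    rw [colorDeriv_insert col hk, Module.End.mul_apply, ← map_smul, ← ih, map_smul]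
    change _ = _ • pderiv (col k) _
    rw [pderiv_orbitSum col Φ hcol hswap F hF hk, smul_smul]
    congr 1
    rw [← Finset.mul_prod_erase _ _ (Finset.mem_univ (col k)),
      ← Finset.mul_prod_erase (a := col k) _ _ (Finset.mem_univ (col k))]
    rw [colorCount_insert col hk, if_pos rfl, Nat.descFactorial_succ]
    rw [Finset.prod_congr rfl (g := fun c =>
      ((colorCount col Finset.univ c).descFactorial (colorCount col V c) : K))]
    · push_cast
      ring
    · intro c hc
      rw [colorCount_insert col hk, if_neg (Finset.ne_of_mem_erase hc).symm, add_zero]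

end ColoredSets

/-! ### Differential operators built from principal minors -/

section Symbols

variable {K : Type*} [Field K]

lemma diffOp_eq_sum (P : MvPolynomial (Fin 2) K) {T : Finset (Fin 2 →₀ ℕ)} (hT : P.support ⊆ T) :
    diffOp P = ∑ α ∈ T, P.coeff α •
      ((partialOp K 0 * partialOp K 1) ^ α 0 * (partialOp K 0 * partialOp K 2) ^ α 1) := by
  apply Finset.sum_subset hT
  intro α _ hα
  rw [notMem_support_iff.1 hα, zero_smul]

lemma diffOp_add (P Q : MvPolynomial (Fin 2) K) : diffOp (P + Q) = diffOp P + diffOp Q := by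
  classical
  rw [diffOp_eq_sum (P + Q) support_add, diffOp_eq_sum P Finset.subset_union_left,
    diffOp_eq_sum Q Finset.subset_union_right, ← Finset.sum_add_distrib]
  simp only [coeff_add, add_smul]

lemma diffOp_sum {ι : Type*} (s : Finset ι) (P : ι → MvPolynomial (Fin 2) K) :
    diffOp (∑ i ∈ s, P i) = ∑ i ∈ s, diffOp (P i) :=
  map_sum (⟨⟨diffOp, by simp [diffOp]⟩, diffOp_add⟩ :
    MvPolynomial (Fin 2) K →+ Module.End K (MvPolynomial (Fin 3) K)) P s

lemma diffOp_monomial (α : Fin 2 →₀ ℕ) (c : K) :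
    diffOp (monomial α c) =
      c • ((partialOp K 0 * partialOp K 1) ^ α 0 * (partialOp K 0 * partialOp K 2) ^ α 1) := by
  classical
  rw [diffOp_eq_sum _ support_monomial_subset]
  simp

lemma diffOp_commute (P Q : MvPolynomial (Fin 2) K) : Commute (diffOp P) (diffOp Q) := by
  have h : ∀ i j k l : Fin 3,
      Commute (partialOp K i * partialOp K j) (partialOp K k * partialOp K l) := fun i j k l =>
    ((partialOp_commute i k).mul_left (partialOp_commute j k)).mul_right
      ((partialOp_commute i l).mul_left (partialOp_commute j l))
  apply Commute.sum_left
  intro α _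
  apply Commute.sum_right
  intro β _
  apply Commute.smul_left
  apply Commute.smul_right
  exact (((h _ _ _ _).pow_pow _ _).mul_left ((h _ _ _ _).pow_pow _ _)).mul_right
    (((h _ _ _ _).pow_pow _ _).mul_left ((h _ _ _ _).pow_pow _ _))

variable {ι : Type*} [Fintype ι] [DecidableEq ι] (col : ι → Fin 3)

/-- The symbol attached to `B`: the coefficients are normalized sums of principal minors. -/
def minorSymbol (B : Matrix ι ι K) : MvPolynomial (Fin 2) K :=
  ∑ V : Finset ι, monomial (Finsupp.single 0 (colorCount col V 1) +
      Finsupp.single 1 (colorCount col V 2))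
    ((∏ c, ((colorCount col Finset.univ c).descFactorial (colorCount col V c) : K))⁻¹ *
      principalMinor B V)

/-- Principal minors of `B` are supported on sets with as many elements of colour `0` as of the
other two colours. -/
def IsBalanced (B : Matrix ι ι K) : Prop :=
  ∀ V, principalMinor B V ≠ 0 → colorCount col V 0 = colorCount col V 1 + colorCount col V 2

/-- The symbol records only colours 1 and 2; balance recovers the power of `∂x` as the sum of the
other two exponents. -/
lemma diffOp_minorSymbol (B : Matrix ι ι K) (hB : IsBalanced col B)
    (f : MvPolynomial (Fin 3) K) :
    diffOp (minorSymbol col B) f = ∑ V : Finset ι,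
      ((∏ c, ((colorCount col Finset.univ c).descFactorial (colorCount col V c) : K))⁻¹ *
        principalMinor B V) • colorDeriv col K V f := by
  rw [minorSymbol, diffOp_sum, LinearMap.sum_apply]
  apply Finset.sum_congr rfl
  intro V _
  rw [diffOp_monomial, LinearMap.smul_apply]
  by_cases h : principalMinor B V = 0
  · simp [h]
  · congr 2
    rw [colorDeriv, hB V h]
    simp only [Finsupp.add_apply, Finsupp.single_eq_same, ne_eq, zero_ne_one, one_ne_zero,
      not_false_eq_true, Finsupp.single_eq_of_ne, add_zero, zero_add]
    rw [(partialOp_commute 0 1).mul_pow, (partialOp_commute 0 2).mul_pow, pow_add]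
    have := ((partialOp_commute (K := K) 0 1).pow_pow (colorCount col V 2) (colorCount col V 1)).eq
    simp only [mul_assoc]
    rw [← mul_assoc (partialOp K 1 ^ _) (partialOp K 0 ^ _), ← this, mul_assoc]

/-- The diagonal matrix of variables prescribed by `col`. -/
def varDiagonal (K : Type*) [Field K] : Matrix ι ι (MvPolynomial (Fin 3) K) :=
  Matrix.diagonal fun i => X (col i)

lemma principalMinor_eq_minorPoly (h2 : (2 : K) ≠ 0) (B : Matrix ι ι K) (S : Finset ι) :
    principalMinor (B.map C + varDiagonal col K) S = minorPoly col B S := by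
  have h2' : IsUnit (2 : MvPolynomial (Fin 3) K) := by
    rw [← map_ofNat (C : K →+* MvPolynomial (Fin 3) K) 2]
    exact (IsUnit.mk0 _ h2).map C
  rw [varDiagonal, principalMinor_add_diagonal h2']
  apply Finset.sum_congr rfl
  intro V _
  rw [principalMinor_map]

variable {H : Type*} [Group H] [Fintype H] (Φ : H →* Equiv.Perm ι)
  (hcol : ∀ h i, col (Φ h i) = col i)
  (hswap : ∀ i j, col i = col j → ∃ h, Φ h = Equiv.swap i j)

include hcol hswap in
/-- Averaging `det (D + B + B')` over sign conjugations and colour-preserving permutations of `B'`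
applies the differential operator with symbol `minorSymbol B'` to `det (D + B)`. -/
theorem sum_sum_det_eq_diffOp (h2 : (2 : K) ≠ 0)
    (hfac : ∀ c, ((colorCount col Finset.univ c).factorial : K) ≠ 0) (B B' : Matrix ι ι K)
    (hB' : IsBalanced col B') :
    ∑ h : H, ∑ δ : ι → ℤˣ, (B.map C + varDiagonal col K +
        signConj δ ((B'.submatrix (Φ h) (Φ h)).map C)).det =
      ((2 : K) ^ Fintype.card ι * Fintype.card H) •
        diffOp (minorSymbol col B') (B.map C + varDiagonal col K).det := by
  have hdesc : ∀ V : Finset ι,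
      (∏ c, ((colorCount col Finset.univ c).descFactorial (colorCount col V c) : K)) ≠ 0 := by
    intro V
    apply Finset.prod_ne_zero_iff.2
    intro c _ h0
    apply hfac c
    rw [← Nat.factorial_mul_descFactorial (colorCount_le col V c), Nat.cast_mul, h0, mul_zero]
  have hdet : (B.map C + varDiagonal col K).det = minorPoly col B Finset.univ := by
    rw [← principalMinor_eq_minorPoly col h2, principalMinor_univ]
  have horb : ∀ V : Finset ι,
      (∏ c, ((colorCount col Finset.univ c).descFactorial (colorCount col V c) : K))⁻¹ •
        (Fintype.card H : K) • colorDeriv col K V (minorPoly col B Finset.univ) =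
      orbitSum Φ (minorPoly col B) V := by
    intro V
    rw [← descFactorial_smul_orbitSum col Φ hcol hswap _ (pderiv_minorPoly col B) V,
      inv_smul_smul₀ (hdesc V)]
  have hterm : ∀ h : H, ∑ δ : ι → ℤˣ, (B.map C + varDiagonal col K +
        signConj δ ((B'.submatrix (Φ h) (Φ h)).map C)).det =
      (2 : K) ^ Fintype.card ι • ∑ V : Finset ι,
        principalMinor B' V • minorPoly col B (V.map (Φ h⁻¹).toEmbedding)ᶜ := by
    intro h
    rw [sum_det_add_signConj, MvPolynomial.smul_eq_C_mul, C_pow, map_ofNat]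
    congr 1
    -- Substitute `V = Φ h (Sᶜ)`, the index set of the minor of `B'` that the permuted minor on `Sᶜ`
    -- equals.
    apply Finset.sum_equiv 
      ((Function.Involutive.toPerm _ (compl_involutive (α := Finset ι))).trans
        (Equiv.finsetCongr (Φ h)))
    · simp
    · intro S _
      rw [principalMinor_eq_minorPoly col h2, principalMinor_map, principalMinor_submatrix,
        MvPolynomial.smul_eq_C_mul, mul_comm]
      simp only [Equiv.trans_apply, Function.Involutive.coe_toPerm, Equiv.finsetCongr_apply]
      have hS : S = ((Sᶜ.map (Φ h).toEmbedding).map (Φ h⁻¹).toEmbedding)ᶜ := by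
        ext x
        simp [Equiv.Perm.inv_def]
      rw [← hS]
  rw [Finset.sum_congr rfl fun h _ => hterm h, ← Finset.smul_sum, Finset.sum_comm, mul_smul,
    diffOp_minorSymbol col B' hB', hdet]
  congr 1
  rw [Finset.smul_sum]
  apply Finset.sum_congr rfl
  intro V _
  have hinv : ∑ h : H, minorPoly col B (V.map (Φ h⁻¹).toEmbedding)ᶜ =
      orbitSum Φ (minorPoly col B) V :=
    Equiv.sum_comp (Equiv.inv H) fun h => minorPoly col B (V.map (Φ h).toEmbedding)ᶜ
  rw [← Finset.smul_sum, hinv, ← horb, smul_smul, smul_smul, smul_smul]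
  congr 1
  ring

include hcol hswap in
/-- The operator with symbol `minorSymbol B` sends the product of the diagonal variables to
`det (B + D)`. -/
theorem diffOp_minorSymbol_prod (h2 : (2 : K) ≠ 0)
    (hfac : ∀ c, ((colorCount col Finset.univ c).factorial : K) ≠ 0)
    (hH : (Fintype.card H : K) ≠ 0) (B : Matrix ι ι K) (hB : IsBalanced col B) :
    diffOp (minorSymbol col B) (∏ i, X (col i)) = (B.map C + varDiagonal col K).det := by
  have key := sum_sum_det_eq_diffOp col Φ hcol hswap h2 hfac 0 B hB
  have hzero : (0 : Matrix ι ι K).map (C : K →+* MvPolynomial (Fin 3) K) + varDiagonal col K =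
      varDiagonal col K := by
    rw [Matrix.map_zero _ (map_zero _), zero_add]
  -- The diagonal matrix is invariant under both actions, so every summand is the determinant of a
  -- conjugate of `B + D`.
  have hterm : ∀ (h : H) (δ : ι → ℤˣ), (varDiagonal col K +
      signConj δ ((B.submatrix (Φ h) (Φ h)).map C)).det = (B.map C + varDiagonal col K).det := by
    intro h δ
    rw [← Matrix.det_submatrix_equiv_self (Φ h) (B.map C + varDiagonal col K),
      ← det_signConj δ (Matrix.submatrix _ _ _)]
    congr 1
    conv_lhs => rw [varDiagonal, ← signConj_diagonal δ]
    ext i j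
    by_cases hij : i = j
    · subst hij
      simp [signConj, varDiagonal, hcol, mul_add, add_comm]
    · simp [signConj, varDiagonal, hij]
  simp only [hzero, hterm, Finset.sum_const, Finset.card_univ] at key
  have hc : Fintype.card (ι → ℤˣ) = 2 ^ Fintype.card ι := by simp
  rw [hc, ← Nat.cast_smul_eq_nsmul K, ← Nat.cast_smul_eq_nsmul K, smul_smul, mul_comm, Nat.cast_pow,
    Nat.cast_ofNat] at key
  have h0 : (2 : K) ^ Fintype.card ι * Fintype.card H ≠ 0 := mul_ne_zero (pow_ne_zero _ h2) hH
  have key := smul_right_injective _ h0 key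
  rw [key, varDiagonal, Matrix.det_diagonal]

end Symbols

/-! ### The skew block matrix and its symmetries -/

section Blocks

variable {K : Type*} [Field K] {s t m : ℕ}

/-- The colour of a column, an upper row or a lower row: `0`, `1` and `2`. -/
def blockColor (m s t : ℕ) : Fin m ⊕ (Fin s ⊕ Fin t) → Fin 3 :=
  Sum.elim (fun _ => 0) (Sum.elim (fun _ => 1) (fun _ => 2))

/-- The skew-symmetric matrix with off-diagonal blocks `Aᵀ` and `-A`. -/
def skewBlock (A : Matrix (Fin s ⊕ Fin t) (Fin m) K) :
    Matrix (Fin m ⊕ (Fin s ⊕ Fin t)) (Fin m ⊕ (Fin s ⊕ Fin t)) K :=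
  Matrix.fromBlocks 0 A.transpose (-A) 0

/-- Schur complement of the lower diagonal block, which is invertible over `K(x, y, z)`: its
determinant is `y^s z^t`, and the opposite signs of `Aᵀ` and `-A` produce the plus signs of the
GSVCP. -/
lemma transformedGsvcp_eq_det (A : Matrix (Fin s ⊕ Fin t) (Fin m) K) :
    transformedGsvcp A =
      algebraMap (MvPolynomial (Fin 3) K) (FractionRing (MvPolynomial (Fin 3) K))
        ((skewBlock A).map C + varDiagonal (blockColor m s t) K).det := by
  set L := FractionRing (MvPolynomial (Fin 3) K)
  have hX : ∀ i, ratVar K i ≠ 0 := fun i => by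
    rw [ratVar, Ne, IsFractionRing.to_map_eq_zero_iff]
    exact X_ne_zero i
  set d : Fin s ⊕ Fin t → L := Sum.elim (fun _ => ratVar K 1) (fun _ => ratVar K 2) with hd
  have hd0 : ∀ i, d i ≠ 0 := by
    rintro (i | i) <;> exact hX _
  let inv : Invertible (Matrix.diagonal d) :=
    ⟨Matrix.diagonal fun i => (d i)⁻¹,
      by rw [Matrix.diagonal_mul_diagonal, ← Matrix.diagonal_one]
         exact congrArg _ (funext fun i => inv_mul_cancel₀ (hd0 i)),
      by rw [Matrix.diagonal_mul_diagonal, ← Matrix.diagonal_one]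
         exact congrArg _ (funext fun i => mul_inv_cancel₀ (hd0 i))⟩
  have h1 : ((skewBlock A).map C + varDiagonal (blockColor m s t) K).map
      (algebraMap (MvPolynomial (Fin 3) K) L) =
      Matrix.fromBlocks (Matrix.diagonal fun _ => ratVar K 0) (A.map (algebraMap K L)).transpose
        (-A.map (algebraMap K L)) (Matrix.diagonal d) := by
    have hC : ∀ a : K, algebraMap (MvPolynomial (Fin 3) K) L (C a) = algebraMap K L a := fun a =>
      (IsScalarTower.algebraMap_apply K (MvPolynomial (Fin 3) K) L a).symm
    ext i j
    rcases i with i | i | i <;> rcases j with j | j | j <;>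
      simp [skewBlock, varDiagonal, blockColor, hC, Matrix.diagonal_apply, hd] <;>
      split_ifs <;> simp [ratVar, L]
  rw [RingHom.map_det, RingHom.mapMatrix_apply, h1, Matrix.det_fromBlocks₂₂, Matrix.det_diagonal,
    Fintype.prod_sum_type, transformedGsvcp, gsvcp, AlgHom.map_det]
  congr 1
  · simp [hd]
  · congr 1
    have hinv : ⅟(Matrix.diagonal d) = Matrix.diagonal fun i => (d i)⁻¹ := rfl
    rw [AlgHom.mapMatrix_apply]
    ext i j
    have hmul : ∀ l, ((Matrix.diagonal fun i => (d i)⁻¹) * A.map (algebraMap K L)) l j =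
        (d l)⁻¹ * algebraMap K L (A l j) := fun l => Matrix.diagonal_mul _ _ _ _
    rw [hinv, Matrix.mul_neg, sub_neg_eq_add, Matrix.mul_assoc, Matrix.add_apply, Matrix.mul_apply,
      Fintype.sum_sum_type, ← add_assoc]
    simp only [hmul]
    simp only [Matrix.transpose_apply, Matrix.map_apply, Matrix.add_apply, Matrix.smul_apply,
      smul_eq_mul, map_add, map_mul, aeval_X, aeval_C, Matrix.mul_apply, map_sum, Finset.mul_sum,
      Matrix.toRows₁_apply, Matrix.toRows₂_apply, hd, Sum.elim_inl, Sum.elim_inr]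
    congr 1
    · congr 1
      · by_cases h : i = j <;> simp [h, Matrix.one_apply]
      · exact Finset.sum_congr rfl fun _ _ => mul_left_comm _ _ _
    · exact Finset.sum_congr rfl fun _ _ => mul_left_comm _ _ _

lemma prod_blockColor : ∏ i, (X (blockColor m s t i) : MvPolynomial (Fin 3) K) =
    baseMonomial K m s t := by
  simp [Fintype.prod_sum_type, blockColor, baseMonomial, mul_assoc]

lemma isBalanced_skewBlock (A : Matrix (Fin s ⊕ Fin t) (Fin m) K) :
    IsBalanced (blockColor m s t) (skewBlock A) := by
  intro V hV
  by_contra hne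
  apply hV
  apply principalMinor_eq_zero_of_bipartite _ (fun i => blockColor m s t i = 0)
  · rintro (i | i | i) (j | j | j) <;> simp [blockColor, skewBlock]
  · intro h
    apply hne
    refine Eq.trans h ?_
    unfold colorCount
    rw [← Finset.card_union_of_disjoint]
    · congr 1
      ext i
      rw [Finset.mem_union, Finset.mem_filter, Finset.mem_filter, Finset.mem_filter]
      generalize blockColor m s t i = c
      fin_cases c <;> simp
    · rw [Finset.disjoint_filter]
      intro i _ h1 h2
      rw [h1] at h2
      exact absurd h2 (by decide)

/-- The action of permutations of the columns, the upper rows and the lower rows. -/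
def blockPerm (m s t : ℕ) :
    Equiv.Perm (Fin m) × Equiv.Perm (Fin s) × Equiv.Perm (Fin t) →*
      Equiv.Perm (Fin m ⊕ (Fin s ⊕ Fin t)) :=
  (Equiv.Perm.sumCongrHom _ _).comp
    (MonoidHom.prodMap (MonoidHom.id _) (Equiv.Perm.sumCongrHom _ _))

lemma blockPerm_apply (h : Equiv.Perm (Fin m) × Equiv.Perm (Fin s) × Equiv.Perm (Fin t)) :
    blockPerm m s t h = Equiv.sumCongr h.1 (Equiv.sumCongr h.2.1 h.2.2) := rfl

lemma blockColor_blockPerm (h : Equiv.Perm (Fin m) × Equiv.Perm (Fin s) × Equiv.Perm (Fin t))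
    (i : Fin m ⊕ (Fin s ⊕ Fin t)) :
    blockColor m s t (blockPerm m s t h i) = blockColor m s t i := by
  rcases i with i | i | i <;> rfl

lemma exists_blockPerm_eq_swap (i j : Fin m ⊕ (Fin s ⊕ Fin t))
    (h : blockColor m s t i = blockColor m s t j) :
    ∃ g, blockPerm m s t g = Equiv.swap i j := by
  rcases i with i | i | i <;> rcases j with j | j | j <;>
    first
    | (exfalso; revert h; simp [blockColor]; done)
    | skip
  · refine ⟨(Equiv.swap i j, 1, 1), ?_⟩
    rw [← Equiv.Perm.sumCongr_swap_one, blockPerm_apply]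
    simp [Equiv.Perm.sumCongr_one]
  · refine ⟨(1, Equiv.swap i j, 1), ?_⟩
    rw [← Equiv.Perm.sumCongr_one_swap, ← Equiv.Perm.sumCongr_swap_one, blockPerm_apply]
  · refine ⟨(1, 1, Equiv.swap i j), ?_⟩
    rw [← Equiv.Perm.sumCongr_one_swap, ← Equiv.Perm.sumCongr_one_swap, blockPerm_apply]

lemma colorCount_blockColor (c : Fin 3) :
    colorCount (blockColor m s t) Finset.univ c = ![m, s, t] c := by
  unfold colorCount
  rw [Finset.card_filter, Fintype.sum_sum_type, Fintype.sum_sum_type]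
  fin_cases c <;> simp [blockColor]

/-! ### Signed permutations as block conjugations -/

/-- The signed permutation matrix with signs `p.1` and permutation `p.2`. -/
def signedPerm (K : Type*) [Field K] {n : ℕ} (p : (Fin n → ℤˣ) × Equiv.Perm (Fin n)) :
    Matrix (Fin n) (Fin n) K :=
  Matrix.diagonal (fun i => (((p.1 i : ℤˣ) : ℤ) : K)) * p.2.permMatrix K

lemma signedPerm_apply {n : ℕ} (p : (Fin n → ℤˣ) × Equiv.Perm (Fin n)) (i j : Fin n) :
    signedPerm K p i j = if p.2 i = j then ((p.1 i : ℤ) : K) else 0 := by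
  rw [signedPerm, Matrix.diagonal_mul]
  simp [Equiv.Perm.permMatrix, PEquiv.toMatrix_apply]

lemma signedPerm_injective (h2 : (2 : K) ≠ 0) {n : ℕ} :
    Function.Injective (signedPerm K (n := n)) := by
  have hunit : ∀ u : ℤˣ, ((u : ℤ) : K) ≠ 0 := fun u => by
    rcases Int.units_eq_one_or u with h | h <;> simp [h]
  have h11 : (1 : K) ≠ -1 := fun h => h2 (by linear_combination h)
  intro p q hpq
  have h := fun i j => congrFun (congrFun hpq i) j
  simp only [signedPerm_apply] at h
  have hperm : p.2 = q.2 := by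
    ext i
    have := h i (p.2 i)
    rw [if_pos rfl] at this
    by_contra hne
    rw [if_neg (fun h => hne (by rw [h]))] at this
    exact hunit _ this
  refine Prod.ext ?_ hperm
  funext i
  have := h i (p.2 i)
  rw [if_pos rfl, if_pos (by rw [hperm])] at this
  rcases Int.units_eq_one_or (p.1 i) with h | h <;> rcases Int.units_eq_one_or (q.1 i) with h' | h' <;>
    rw [h, h'] at this ⊢ <;> simp at this
  · exact absurd this h11
  · exact absurd this.symm h11

/-- Since `1 ≠ -1` in `K`, distinct pairs of signs and permutation give distinct matrices, so
averaging over matrices is averaging over pairs. -/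
lemma uniformExpect_signedPermMatrices (h2 : (2 : K) ≠ 0) {L : Type*} [Field L] (n : ℕ)
    (f : Matrix (Fin n) (Fin n) K → L) :
    uniformExpect (signedPermMatrices K n) f =
      ((2 : L) ^ n * (n.factorial : L))⁻¹ *
        ∑ p : (Fin n → ℤˣ) × Equiv.Perm (Fin n), f (signedPerm K p) := by
  classical
  have hS : signedPermMatrices K n = Finset.univ.image (signedPerm K (n := n)) := by
    ext
    simp [signedPermMatrices, signedPerm]
  have hc : (signedPermMatrices K n).card = 2 ^ n * n.factorial := by
    rw [hS, Finset.card_image_of_injective _ (signedPerm_injective h2)]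
    simp [Fintype.card_perm]
  rw [uniformExpect, hc, hS, Finset.sum_image (signedPerm_injective h2).injOn]
  push_cast
  rfl

/-- Signs of a signed permutation are indexed by rows. Multiplying on the right, column `j` comes
from column `p₀.2⁻¹ j` with the sign found there, hence the inverses. -/
lemma skewBlock_blockSum (M N : Matrix (Fin s ⊕ Fin t) (Fin m) K)
    (p₁ : (Fin s → ℤˣ) × Equiv.Perm (Fin s)) (p₂ : (Fin t → ℤˣ) × Equiv.Perm (Fin t))
    (p₀ : (Fin m → ℤˣ) × Equiv.Perm (Fin m)) :
    skewBlock (blockSum M N (signedPerm K p₁) (signedPerm K p₂) (signedPerm K p₀)) =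
      skewBlock M + signConj (Sum.elim (p₀.1 ∘ ⇑p₀.2⁻¹) (Sum.elim p₁.1 p₂.1))
        ((skewBlock N).submatrix (blockPerm m s t (p₀.2⁻¹, p₁.2, p₂.2))
          (blockPerm m s t (p₀.2⁻¹, p₁.2, p₂.2))) := by
  have key : ∀ {r : ℕ} (p : (Fin r → ℤˣ) × Equiv.Perm (Fin r)) (A : Matrix (Fin r) (Fin m) K)
      (i : Fin r) (j : Fin m), (signedPerm K p * A * signedPerm K p₀) i j =
        ((p.1 i : ℤ) : K) * ((p₀.1 (p₀.2⁻¹ j) : ℤ) : K) * A (p.2 i) (p₀.2⁻¹ j) := by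
    intro r p A i j
    rw [Matrix.mul_apply, Finset.sum_eq_single (p₀.2⁻¹ j), Matrix.mul_apply,
      Finset.sum_eq_single (p.2 i), signedPerm_apply, signedPerm_apply, if_pos rfl,
      if_pos (by simp)]
    · ring
    · intro l _ hl
      rw [signedPerm_apply, if_neg hl.symm, zero_mul]
    · simp
    · intro l _ hl
      rw [signedPerm_apply, if_neg (fun h => hl (by rw [← h]; simp)), mul_zero]
    · simp
  ext i j
  rcases i with i | i | i <;> rcases j with j | j | j <;>
    simp [-mul_eq_mul_right_iff, skewBlock, blockSum, signConj, key, blockPerm_apply, Matrix.toRows₁, Matrix.toRows₂] <;>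
    ring

/-- Signs and permutations of the three blocks, regrouped as block permutations and one family of
signs. -/
def signedPermEquiv (m s t : ℕ) :
    ((Fin s → ℤˣ) × Equiv.Perm (Fin s)) × ((Fin t → ℤˣ) × Equiv.Perm (Fin t)) ×
      ((Fin m → ℤˣ) × Equiv.Perm (Fin m)) ≃
    (Equiv.Perm (Fin m) × Equiv.Perm (Fin s) × Equiv.Perm (Fin t)) ×
      (Fin m ⊕ (Fin s ⊕ Fin t) → ℤˣ) where
  toFun p := ((p.2.2.2⁻¹, p.1.2, p.2.1.2),
    Sum.elim (p.2.2.1 ∘ ⇑p.2.2.2⁻¹) (Sum.elim p.1.1 p.2.1.1))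
  invFun q := ((q.2 ∘ Sum.inr ∘ Sum.inl, q.1.2.1), (q.2 ∘ Sum.inr ∘ Sum.inr, q.1.2.2),
    (q.2 ∘ Sum.inl ∘ ⇑q.1.1⁻¹, q.1.1⁻¹))
  left_inv := by
    rintro ⟨⟨e₁, r₁⟩, ⟨e₂, r₂⟩, ⟨e₀, r₀⟩⟩
    simp only [Prod.mk.injEq, inv_inv, and_true]
    refine ⟨rfl, rfl, ?_⟩
    funext i
    simp
  right_inv := by
    rintro ⟨⟨r₀, r₁, r₂⟩, e⟩
    simp only [Prod.mk.injEq, inv_inv, true_and]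
    funext i
    rcases i with i | i | i <;> simp

end Blocks

/-! ### Existence of symbols and the expected polynomial -/

section Main

variable {K : Type*} [Field K] {s t m : ℕ}

lemma colorCount_blockColor_factorial_ne_zero (hm : (m.factorial : K) ≠ 0)
    (hs : (s.factorial : K) ≠ 0) (ht : (t.factorial : K) ≠ 0) (c : Fin 3) :
    ((colorCount (blockColor m s t) Finset.univ c).factorial : K) ≠ 0 := by
  rw [colorCount_blockColor]
  fin_cases c
  · exact hm
  · exact hs
  · exact ht

lemma card_blockPerm_ne_zero (hm : (m.factorial : K) ≠ 0)
    (hs : (s.factorial : K) ≠ 0) (ht : (t.factorial : K) ≠ 0) :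
    (Fintype.card (Equiv.Perm (Fin m) × Equiv.Perm (Fin s) × Equiv.Perm (Fin t)) : K) ≠ 0 := by
  simp [Fintype.card_perm, hm, hs, ht]

/-- The canonical symbol of a block matrix. -/
def blockSymbol (A : Matrix (Fin s ⊕ Fin t) (Fin m) K) : MvPolynomial (Fin 2) K :=
  minorSymbol (blockColor m s t) (skewBlock A)

theorem isSymbol_blockSymbol (h2 : (2 : K) ≠ 0) (hm : (m.factorial : K) ≠ 0)
    (hs : (s.factorial : K) ≠ 0) (ht : (t.factorial : K) ≠ 0)
    (A : Matrix (Fin s ⊕ Fin t) (Fin m) K) : IsSymbol A (blockSymbol A) := by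
  rw [IsSymbol, transformedGsvcp_eq_det, blockSymbol, ← prod_blockColor,
    diffOp_minorSymbol_prod (blockColor m s t) (blockPerm m s t) blockColor_blockPerm
      exists_blockPerm_eq_swap h2 (colorCount_blockColor_factorial_ne_zero hm hs ht)
      (card_blockPerm_ne_zero hm hs ht) _ (isBalanced_skewBlock A)]

/-- The expected transformed polynomial is obtained by applying the operator of the canonical
symbol of `N`. -/
theorem uniformExpect_transformedGsvcp (h2 : (2 : K) ≠ 0) (hm : (m.factorial : K) ≠ 0)
    (hs : (s.factorial : K) ≠ 0) (ht : (t.factorial : K) ≠ 0)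
    (M N : Matrix (Fin s ⊕ Fin t) (Fin m) K) :
    (uniformExpect (signedPermMatrices K s) fun R₁ =>
      uniformExpect (signedPermMatrices K t) fun R₂ =>
        uniformExpect (signedPermMatrices K m) fun U =>
          transformedGsvcp (blockSum M N R₁ R₂ U)) =
      algebraMap (MvPolynomial (Fin 3) K) (FractionRing (MvPolynomial (Fin 3) K))
        (diffOp (blockSymbol N)
          ((skewBlock M).map C + varDiagonal (blockColor m s t) K).det) := by
  set L := FractionRing (MvPolynomial (Fin 3) K)
  set c : K := (2 : K) ^ Fintype.card (Fin m ⊕ (Fin s ⊕ Fin t)) *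
    Fintype.card (Equiv.Perm (Fin m) × Equiv.Perm (Fin s) × Equiv.Perm (Fin t)) with hc
  have hc0 : c ≠ 0 := mul_ne_zero (pow_ne_zero _ h2) (card_blockPerm_ne_zero hm hs ht)
  have key := sum_sum_det_eq_diffOp (blockColor m s t) (blockPerm m s t) blockColor_blockPerm
      exists_blockPerm_eq_swap h2 (colorCount_blockColor_factorial_ne_zero hm hs ht)
      (skewBlock M) (skewBlock N) (isBalanced_skewBlock N)
  have hmap : ∀ (δ : Fin m ⊕ (Fin s ⊕ Fin t) → ℤˣ)
      (B : Matrix (Fin m ⊕ (Fin s ⊕ Fin t)) (Fin m ⊕ (Fin s ⊕ Fin t)) K),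
      (signConj δ B).map (C : K →+* MvPolynomial (Fin 3) K) = signConj δ (B.map C) := by
    intro δ B
    ext i j
    simp [signConj]
  have hsum : ∑ p₁ : (Fin s → ℤˣ) × Equiv.Perm (Fin s), ∑ p₂ : (Fin t → ℤˣ) × Equiv.Perm (Fin t),
      ∑ p₀ : (Fin m → ℤˣ) × Equiv.Perm (Fin m), ((skewBlock (blockSum M N (signedPerm K p₁)
        (signedPerm K p₂) (signedPerm K p₀))).map C + varDiagonal (blockColor m s t) K).det =
      c • diffOp (blockSymbol N) ((skewBlock M).map C + varDiagonal (blockColor m s t) K).det := by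
    rw [blockSymbol, hc, ← key, ← Fintype.sum_prod_type']
    simp_rw [← Fintype.sum_prod_type']
    apply Fintype.sum_equiv ((Equiv.prodAssoc _ _ _).trans (signedPermEquiv m s t))
    rintro ⟨⟨p₁, p₂⟩, p₀⟩
    simp only [skewBlock_blockSum, Matrix.map_add (C : K →+* MvPolynomial (Fin 3) K) (map_add C),
      hmap, signedPermEquiv, Equiv.trans_apply, Equiv.prodAssoc_apply, Equiv.coe_fn_mk]
    rw [add_right_comm]
  -- The three normalizations multiply to the inverse of the number of signs times the order of the
  -- block permutation group.
  have hcL : ((2 : L) ^ s * (s.factorial : L))⁻¹ * (((2 : L) ^ t * (t.factorial : L))⁻¹ *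
      ((2 : L) ^ m * (m.factorial : L))⁻¹) = (algebraMap K L c)⁻¹ := by
    rw [← mul_inv, ← mul_inv, hc]
    congr 1
    simp only [Fintype.card_sum, Fintype.card_fin, Fintype.card_prod, Fintype.card_perm, map_mul,
      map_pow, map_ofNat, map_natCast, Nat.cast_mul, pow_add]
    ring
  clear_value c
  simp only [uniformExpect_signedPermMatrices h2, transformedGsvcp_eq_det, ← Finset.mul_sum]
  rw [← mul_assoc, ← mul_assoc, mul_assoc _ _ (_ : L)⁻¹, hcL]
  simp only [← map_sum]
  rw [hsum, MvPolynomial.smul_eq_C_mul, map_mul]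
  have hC : algebraMap (MvPolynomial (Fin 3) K) L (C c) = algebraMap K L c :=
    (IsScalarTower.algebraMap_apply K (MvPolynomial (Fin 3) K) L c).symm
  rw [hC, inv_mul_cancel_left₀]
  exact (map_ne_zero _).2 hc0

end Main

end GSVD

end

open GSVD in
theorem mainTheorem5 {K : Type*} [Field K] (s t m : ℕ)
    (hK : (2 : K) * (m.factorial : K) * (s.factorial : K) * (t.factorial : K) ≠ 0)
    (M N : Matrix (Fin s ⊕ Fin t) (Fin m) K) :
    (∃ P : MvPolynomial (Fin 2) K, IsSymbol M P) ∧
    (∃ Q : MvPolynomial (Fin 2) K, IsSymbol N Q) ∧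
    ∀ P Q : MvPolynomial (Fin 2) K, IsSymbol M P → IsSymbol N Q →
      (uniformExpect (signedPermMatrices K s) fun R₁ =>
        uniformExpect (signedPermMatrices K t) fun R₂ =>
          uniformExpect (signedPermMatrices K m) fun U =>
            transformedGsvcp (blockSum M N R₁ R₂ U)) =
        algebraMap (MvPolynomial (Fin 3) K) (FractionRing (MvPolynomial (Fin 3) K))
          ((diffOp P * diffOp Q) (baseMonomial K m s t)) := by
  have ht := right_ne_zero_of_mul hK
  have hs := right_ne_zero_of_mul (left_ne_zero_of_mul hK)
  have hm := right_ne_zero_of_mul (left_ne_zero_of_mul (left_ne_zero_of_mul hK))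
  have h2 := left_ne_zero_of_mul (left_ne_zero_of_mul (left_ne_zero_of_mul hK))
  refine ⟨⟨_, isSymbol_blockSymbol h2 hm hs ht M⟩, ⟨_, isSymbol_blockSymbol h2 hm hs ht N⟩, ?_⟩
  intro P Q hP hQ
  have hinj := IsFractionRing.injective (MvPolynomial (Fin 3) K)
    (FractionRing (MvPolynomial (Fin 3) K))
  -- Symbols need not be unique; `P` and `Q` enter only through their values on the base monomial,
  -- and commutation lets `Q` replace the canonical symbol of `N`.
  have hP' := hinj ((transformedGsvcp_eq_det M).symm.trans hP)
  have hQ' := hinj (hQ.symm.trans (isSymbol_blockSymbol h2 hm hs ht N))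
  rw [uniformExpect_transformedGsvcp h2 hm hs ht, hP', Module.End.mul_apply, hQ',
    ← Module.End.mul_apply, ← Module.End.mul_apply, (diffOp_commute _ _).eq]
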